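/- For a finite simple graph $G$ let $\alpha(G)$ be its stability number, let $\mathrm{FRAC}(G)=\{x\in[0,1]^{V(G)} : x_i+x_j\le 1 \text{ for all } \{i,j\}\in E(G)\}$, and let $\alpha_{LS_+}(G)=\max\{\sum_{i} x_i : x\in LS_+(\mathrm{FRAC}(G))\}$. Here, for $P\subseteq[0,1]^n$ with $K(P)=\{(\lambda,\lambda x) : \lambda\ge 0,\ x\in P\}\subseteq\mathbb{R}^{n+1}$ (the extra coordinate is indexed by $0$), $LS_+(P)$ is the set of all $x\in\mathbb{R}^n$ for which there is a real symmetric positive semidefinite $(n+1)\times(n+1)$ matrix $Y$ with $Ye_0=\mathrm{diag}(Y)=(1,x)$ and $Ye_i,\ Y(e_0-e_i)\in K(P)$ for all $i\in\{1,\dots,n\}$. For integers $0\le i\le\min\{q,p-q\}$ let $J_{p,q,i}$ be the $0,1$-matrix indexed by the $q$-element subsets of $\{1,\dots,p\}$ whose $(S,T)$ entry is $1$ if and only if $|S\cap T|=q-i$; for $i\ge1$ let $G(J_{p,q,i})$ be the graph with adjacency matrix $J_{p,q,i}$. Let $p\ge 4$ and $q\ge 2$ be integers. (i) Let $G=\overline{G(J_{p,q,1})}$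 be the complement of the Johnson graph. If $p\ge 2q$, then $\alpha_{LS_+}(G)=p-q+1=\alpha(G)$. If $q<p<2q$, then $\alpha_{LS_+}(G)=q+1=\alpha(G)$. (ii) Suppose $p\ge 2q$ and let $G=\overline{G(J_{p,q,q})}$ be the complement of the Kneser graph. Then $\alpha_{LS_+}(G)=p/q$ and $\alpha(G)=\lfloor p/q\rfloor$; in particular $\alpha_{LS_+}(G)=\alpha(G)$ if and only if $q\mid p$. In both parts the maximum defining $\alpha_{LS_+}(G)$ is attained. -/

import Mathlib

/-- `[p]_q`: the `q`-element subsets of a `p`-element set. -/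
abbrev QSubset (p q : ℕ) : Type := {S : Finset (Fin p) // S.card = q}

/-- The matrix `J_{p,q,i}` (for `i ≤ q`): its `(S,T)` entry is `1` if `|S ∩ T| = q - i` and `0`
otherwise. The condition is written additively to avoid truncated subtraction. -/
def johnsonMatrix (p q i : ℕ) : Matrix (QSubset p q) (QSubset p q) ℝ :=
  Matrix.of fun S T => if (S.1 ∩ T.1).card + i = q then 1 else 0

theorem johnsonMatrix_isAdjMatrix (p q i : ℕ) (hi : 1 ≤ i) :
    (johnsonMatrix p q i).IsAdjMatrix where
  zero_or_one S T := by
    by_cases h : (S.1 ∩ T.1).card + i = q <;> simp [johnsonMatrix, h]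
  symm := by
    ext S T
    simp [johnsonMatrix, Matrix.transpose_apply, Finset.inter_comm]
  apply_diag S := by
    have hS := S.2
    have h : ¬ ((S.1 ∩ S.1).card + i = q) := by
      rw [Finset.inter_self]
      omega
    simp only [johnsonMatrix, Matrix.of_apply, if_neg h]

/-- `G(J_{p,q,i})`, `i ≥ 1`: the graph whose adjacency matrix is `J_{p,q,i}`. For `i = 1` it is the
Johnson graph, for `i = q` the Kneser graph. -/
def johnsonGraph (p q i : ℕ) (hi : 1 ≤ i) : SimpleGraph (QSubset p q) :=
  (johnsonMatrix_isAdjMatrix p q i hi).toGraph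

theorem johnsonGraph_adj (p q i : ℕ) (hi : 1 ≤ i) (S T : QSubset p q) :
    (johnsonGraph p q i hi).Adj S T ↔ (S.1 ∩ T.1).card + i = q := by
  simp [johnsonGraph, johnsonMatrix]

section LovaszSchrijver

variable {V : Type*}

/-- The homogenized cone `K(P) = {(t, t x) : t ≥ 0, x ∈ P}`; the extra coordinate `0` is `none`. -/
def homogenizedCone (P : Set (V → ℝ)) : Set (Option V → ℝ) :=
  {y | ∃ t : ℝ, 0 ≤ t ∧ ∃ x ∈ P, y none = t ∧ ∀ i : V, y (some i) = t * x i}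

/-- The vector `(1, x)`. -/
def liftVec (x : V → ℝ) : Option V → ℝ := fun o => o.elim 1 x

/-- The unit vector `e_j` of `ℝ^(n+1)`. -/
noncomputable def unitVec [DecidableEq V] (j : Option V) : Option V → ℝ := Pi.single j 1

/-- The Lovász–Schrijver operator `LS_+`. -/
def LSPlus [Fintype V] [DecidableEq V] (P : Set (V → ℝ)) : Set (V → ℝ) :=
  {x | ∃ Y : Matrix (Option V) (Option V) ℝ,
    Y.IsSymm ∧
    Y.mulVec (unitVec none) = liftVec x ∧
    Y.diag = liftVec x ∧
    (∀ i : V, Y.mulVec (unitVec (some i)) ∈ homogenizedCone P ∧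
      Y.mulVec (unitVec none - unitVec (some i)) ∈ homogenizedCone P) ∧
    Y.PosSemidef}

/-- The fractional stable set polytope `FRAC(G)`. -/
def FRAC (G : SimpleGraph V) : Set (V → ℝ) :=
  {x | (∀ i, 0 ≤ x i ∧ x i ≤ 1) ∧ ∀ i j, G.Adj i j → x i + x j ≤ 1}

/-- The values of the objective function `∑ i, x i` over `LS_+(FRAC(G))`. -/
def lsPlusValues [Fintype V] [DecidableEq V] (G : SimpleGraph V) : Set ℝ :=
  {s | ∃ x ∈ LSPlus (FRAC G), s = ∑ i, x i}

/-- `α_{LS_+}(G)`, the optimum of `∑ i, x i` over `LS_+(FRAC(G))`. -/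
noncomputable def alphaLSPlus [Fintype V] [DecidableEq V] (G : SimpleGraph V) : ℝ :=
  sSup (lsPlusValues G)

end LovaszSchrijver

/-!
A certificate `Y` for a point `x` of `LS_+(FRAC(G))` vanishes on the edges of `G`, so `LS_+` is at
least as strong as Lovász's theta function. Dually (`sum_le_of_mem_LSPlus`), any Gram matrix which
is constant on the diagonal and on the pairs of distinct non-adjacent vertices bounds `∑ v, x v`.
Stable sets give points of `LS_+(FRAC(G))` by rank one certificates, so `α(G) ≤ α_{LS_+}(G)`.

*Complements of Johnson graphs.* For `p ≥ 2q` the Gram matrix is the projection onto the last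
eigenspace of the Johnson scheme, up to scaling. It is realized by the functions
`S ↦ ∏ j, (1_S(a_j) - 1_S(b_j))` over all systems of `q` disjoint pairs `{a_j, b_j}`. If `S` is a
transversal of the pairs and `u ∈ S`, then exchanging `u` for its partner flips the sign and every
other exchange gives `0`; with the symmetry under permutations of the ground set, the entry at two
sets meeting in `q - 1` points is `-1 / (p - q)` times the diagonal one
(`sum_pairProduct_mul_exchange`). The resulting bound `p - q + 1` is the size of the stable set of
all `q`-sets containing a given `(q-1)`-set. For `q < p < 2q` the same Gram matrix is applied to the
complements of the `q`-sets, and the bound `q + 1` is the size of the stable set of all `q`-subsets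
of a given `(q+1)`-set.

*Complements of Kneser graphs.* The vectors `1_S - q / p` give the bound `p / q`
(`sum_le_of_mem_LSPlus_kneser`). It is attained by the constant vector `x = 1 / C(p-1, q-1)` with the
certificate whose entries at disjoint pairs are `x / C(p-q-1, q-1)`. That it is positive semidefinite
says that the Kneser graph has no eigenvalue below `-C(p-q-1, q-1)`. An eigenvector `v` that is
not constant is moved by some transposition of points `a`, `b`; the difference `w` of `v` and its
image is again an eigenvector, and is supported on the sets separating `a` from `b`. In such a set
`S`, say with `a ∈ S`, only the `C(p-q-1, q-1)` neighbours containing `b` can be in the support, so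
the eigenvalue has absolute value at most `C(p-q-1, q-1)` (`kneserSchur_eigenvalue_nonneg`).
-/

/-! ### The operator `LS_+` on fractional stable set polytopes -/

section LovaszSchrijver

variable {V : Type*}

theorem LSPlus_FRAC_apply_eq_zero [Fintype V] [DecidableEq V] {G : SimpleGraph V}
    {Y : Matrix (Option V) (Option V) ℝ} {x : V → ℝ} {v w : V}
    (hnone : Y none (some v) = x v) (hdiag : Y (some v) (some v) = x v)
    (hK : Y.mulVec (unitVec (some v)) ∈ homogenizedCone (FRAC G)) (hvw : G.Adj v w) :
    Y (some w) (some v) = 0 := by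
  obtain ⟨t, -, z, ⟨hz, hadj⟩, h0, hi⟩ := hK
  simp only [unitVec, Matrix.mulVec_single_one, Matrix.col_apply] at h0 hi
  have hv := hi v
  rw [hi w]
  rcases eq_or_ne t 0 with rfl | hne
  · simp
  -- column `v` is `x v • (1, z)` with `z v = 1`, so the edge inequality forces `z w = 0`
  · have : z v = 1 := by
      have : t * z v = t * 1 := by rw [← hv, hdiag, ← hnone, h0, mul_one]
      exact mul_left_cancel₀ hne this
    have := hadj v w hvw
    have := (hz w).1
    rw [show z w = 0 by linarith, mul_zero]

/-- The bound by Lovász's theta function, in dual form: a Gram matrix `∑ k, f k v * f k w` that is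
`c * (t - 1)` on the diagonal and `-c` on the distinct non-adjacent pairs gives `∑ v, x v ≤ t`.
Only the vanishing of the certificate `Y` on the edges is used. -/
theorem sum_le_of_mem_LSPlus [Fintype V] [DecidableEq V] {G : SimpleGraph V} {x : V → ℝ}
    (hx : x ∈ LSPlus (FRAC G)) {K : Type*} [Fintype K] (f : K → V → ℝ) {c t : ℝ} (hc : 0 < c)
    (ht : 0 ≤ t) (hdiag : ∀ v, ∑ k, f k v * f k v = c * (t - 1))
    (hoff : ∀ v w, v ≠ w → ¬ G.Adj v w → ∑ k, f k v * f k w = -c) :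
    ∑ v, x v ≤ t := by
  obtain ⟨Y, hsymm, hY0, hYd, hK, hpsd⟩ := hx
  have hcol : ∀ v, Y (some v) none = x v := fun v => by
    have := congrFun hY0 (some v)
    simpa [unitVec, liftVec] using this
  have h00 : Y none none = 1 := by
    have := congrFun hY0 none
    simpa [unitVec, liftVec] using this
  have hrow : ∀ v, Y none (some v) = x v := fun v => by rw [← hcol v, hsymm.apply]
  have hd : ∀ v, Y (some v) (some v) = x v := fun v => by
    have := congrFun hYd (some v)
    simpa [liftVec] using this
  have hedge : ∀ v w, G.Adj v w → Y (some v) (some w) = 0 := fun v w h =>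
    LSPlus_FRAC_apply_eq_zero (hrow w) (hd w) (hK w).1 h.symm
  have hquad : ∀ (a : ℝ) (g : V → ℝ), 0 ≤ a * a + 2 * a * ∑ v, x v * g v
      + ∑ v, ∑ w, Y (some v) (some w) * (g v * g w) := fun a g => by
    have := hpsd.dotProduct_mulVec_nonneg (fun o => o.elim a g)
    simp only [dotProduct, Matrix.mulVec, Fintype.sum_option, Pi.star_apply, star_trivial,
      Option.elim, h00, hrow, hcol] at this
    refine this.trans_eq ?_
    simp only [mul_add, Finset.sum_add_distrib, Finset.mul_sum]
    have h1 : ∑ v, g v * (x v * a) = ∑ v, a * (x v * g v) :=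
      Finset.sum_congr rfl fun v _ => by ring
    have h2 : ∑ v, ∑ w, g v * (Y (some v) (some w) * g w)
        = ∑ v, ∑ w, Y (some v) (some w) * (g v * g w) :=
      Finset.sum_congr rfl fun v _ => Finset.sum_congr rfl fun w _ => by ring
    have h3 : ∑ v, 2 * a * (x v * g v) = ∑ v, a * (x v * g v) + ∑ v, a * (x v * g v) := by
      rw [← Finset.sum_add_distrib]
      exact Finset.sum_congr rfl fun v _ => by ring
    rw [h1, h2, h3]
    ring
  set s := ∑ v, x v with hs
  set Z := ∑ v, ∑ w, Y (some v) (some w) with hZ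
  have hsZ : s * s ≤ Z := by
    have := hquad (-s) (fun _ => 1)
    simp only [mul_one, ← hs, ← hZ] at this
    linarith
  have hterm : ∀ v w, Y (some v) (some w) * ∑ k, f k v * f k w
      = -c * Y (some v) (some w) + if v = w then c * t * x v else 0 := fun v w => by
    split_ifs with h
    · subst h
      rw [hdiag, hd]
      ring
    · by_cases hadj : G.Adj v w
      · simp [hedge v w hadj]
      · rw [hoff v w h hadj]
        ring
  have hZs : c * Z ≤ c * (t * s) := by
    have h1 : 0 ≤ ∑ k, ∑ v, ∑ w, Y (some v) (some w) * (f k v * f k w) :=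
      Finset.sum_nonneg fun k _ => by simpa using hquad 0 (f k)
    have h2 : ∑ k, ∑ v, ∑ w, Y (some v) (some w) * (f k v * f k w)
        = ∑ v, ∑ w, Y (some v) (some w) * ∑ k, f k v * f k w := by
      rw [Finset.sum_comm]
      refine Finset.sum_congr rfl fun v _ => ?_
      rw [Finset.sum_comm]
      exact Finset.sum_congr rfl fun w _ => by rw [Finset.mul_sum]
    rw [h2] at h1
    simp only [hterm, Finset.sum_add_distrib, Finset.sum_ite_eq, Finset.mem_univ, if_true,
      ← Finset.mul_sum, ← hs, ← hZ] at h1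
    linarith
  have hst : s * s ≤ t * s := hsZ.trans (le_of_mul_le_mul_left hZs hc)
  by_contra! hlt
  exact absurd (le_of_mul_le_mul_right hst (ht.trans_lt hlt)) (not_le.mpr hlt)

theorem smul_indicator_mem_homogenizedCone {G : SimpleGraph V} {s : Set V}
    [DecidablePred (· ∈ s)] (hs : G.IsIndepSet s) {a : ℝ} (ha : 0 ≤ a) :
    (fun o : Option V => a * o.elim 1 fun v => if v ∈ s then 1 else 0)
      ∈ homogenizedCone (FRAC G) := by
  refine ⟨a, ha, fun v => if v ∈ s then 1 else 0, ⟨fun v => ?_, fun v w h => ?_⟩, by simp, by simp⟩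
  · dsimp only
    split_ifs <;> norm_num
  · dsimp only
    split_ifs with hv hw
    · exact absurd h (hs hv hw h.ne)
    all_goals norm_num

/-- The incidence vector of a stable set `s` lies in `LS_+(FRAC(G))`, by the rank one certificate
`(1, x) (1, x)ᵀ`. -/
theorem card_mem_lsPlusValues [Fintype V] [DecidableEq V] {G : SimpleGraph V} {s : Finset V}
    (hs : G.IsIndepSet s) : (s.card : ℝ) ∈ lsPlusValues G := by
  set x : V → ℝ := fun v => if v ∈ s then 1 else 0 with hx
  have hxx : ∀ v, x v * x v = x v := fun v => by simp [hx]
  have hcone : ∀ a : ℝ, 0 ≤ a → (fun o => a * liftVec x o) ∈ homogenizedCone (FRAC G) :=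
    fun a ha => by simpa [liftVec, hx] using smul_indicator_mem_homogenizedCone hs ha
  refine ⟨x, ⟨Matrix.vecMulVec (liftVec x) (liftVec x), ?_, ?_, ?_, fun v => ⟨?_, ?_⟩, ?_⟩, ?_⟩
  · ext i j
    simp [Matrix.vecMulVec_apply, mul_comm]
  · ext i
    simp [unitVec, Matrix.vecMulVec_apply, liftVec]
  · ext i
    cases i <;> simp [Matrix.vecMulVec_apply, liftVec, hxx]
  · convert hcone (x v) (by simp only [hx]; split_ifs <;> norm_num) using 1
    ext o
    simp [unitVec, Matrix.vecMulVec_apply, liftVec, mul_comm]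
  · convert hcone (1 - x v) (by simp only [hx]; split_ifs <;> norm_num) using 1
    ext o
    simp only [Matrix.mulVec_sub, unitVec, Matrix.mulVec_single_one, Pi.sub_apply, Matrix.col_apply,
      Matrix.vecMulVec_apply]
    simp only [liftVec, Option.elim]
    ring
  · simpa using Matrix.posSemidef_vecMulVec_self_star (liftVec x)
  · simp [hx]

theorem indepNum_mem_lsPlusValues [Fintype V] [DecidableEq V] (G : SimpleGraph V) :
    (G.indepNum : ℝ) ∈ lsPlusValues G := by
  obtain ⟨s, hs⟩ := G.exists_isNIndepSet_indepNum
  rw [← hs.card_eq]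
  exact card_mem_lsPlusValues hs.isIndepSet

theorem card_le_indepNum [Finite V] {G : SimpleGraph V} {ι : Type*} [Fintype ι] (g : ι → V)
    (hg : Function.Injective g) (hadj : ∀ i j, ¬ G.Adj (g i) (g j)) :
    Fintype.card ι ≤ G.indepNum := by
  have hs : G.IsIndepSet (Finset.univ.map ⟨g, hg⟩ : Finset V) := by
    intro v hv w hw _
    simp only [Finset.coe_map, Function.Embedding.coeFn_mk, Finset.coe_univ, Set.image_univ,
      Set.mem_range] at hv hw
    obtain ⟨i, rfl⟩ := hv
    obtain ⟨j, rfl⟩ := hw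
    exact hadj i j
  simpa using hs.card_le_indepNum

/-- If an upper bound `t` for `LS_+` is the size of a stable set, then it is the optimum and the
stability number. -/
theorem alphaLSPlus_eq_of_le_indepNum [Fintype V] [DecidableEq V] {G : SimpleGraph V} {t : ℝ}
    (hle : ∀ x ∈ LSPlus (FRAC G), ∑ v, x v ≤ t) (hge : t ≤ G.indepNum) :
    IsGreatest (lsPlusValues G) (alphaLSPlus G) ∧ alphaLSPlus G = t ∧ (G.indepNum : ℝ) = t := by
  have hub : t ∈ upperBounds (lsPlusValues G) := by
    rintro _ ⟨x, hx, rfl⟩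
    exact hle x hx
  have ht : (G.indepNum : ℝ) = t := (hub (indepNum_mem_lsPlusValues G)).antisymm hge
  have hmax : IsGreatest (lsPlusValues G) t := ⟨ht ▸ indepNum_mem_lsPlusValues G, hub⟩
  have : alphaLSPlus G = t := hmax.csSup_eq
  exact ⟨this ▸ hmax, this, ht⟩

end LovaszSchrijver

/-! ### Finite sets of equal size -/

theorem Finset.exists_perm_map_eq {α : Type*} [Fintype α] [DecidableEq α] {S T : Finset α}
    (h : S.card = T.card) : ∃ σ : Equiv.Perm α, S.map σ.toEmbedding = T := by
  have e : {a // a ∈ S} ≃ {a // a ∈ T} := Fintype.equivOfCardEq (by simpa using h)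
  refine ⟨e.extendSubtype, Finset.eq_of_subset_of_card_le (fun b hb => ?_) (by simp [h])⟩
  obtain ⟨a, ha, rfl⟩ := Finset.mem_map.mp hb
  exact e.extendSubtype_mem a ha

/-- Two sets of equal size `q` meeting in `q - 1` points differ by exchanging one point. -/
theorem Finset.eq_insert_erase_of_card_inter {α : Type*} [DecidableEq α] {S T : Finset α}
    (hST : S.card = T.card) (h : (S ∩ T).card + 1 = S.card) :
    ∃ u ∈ S, ∃ v ∉ S, T = insert v (S.erase u) := by
  have h1 : (S \ T).card = 1 := by
    have := Finset.card_sdiff_add_card_inter S T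
    omega
  have h2 : (T \ S).card = 1 := by
    have := Finset.card_sdiff_add_card_inter T S
    rw [Finset.inter_comm] at this
    omega
  obtain ⟨u, hu⟩ := Finset.card_eq_one.mp h1
  obtain ⟨v, hv⟩ := Finset.card_eq_one.mp h2
  have hu' : ∀ a, (a ∈ S ∧ a ∉ T) ↔ a = u := fun a => by
    rw [← Finset.mem_sdiff, hu, Finset.mem_singleton]
  have hv' : ∀ a, (a ∈ T ∧ a ∉ S) ↔ a = v := fun a => by
    rw [← Finset.mem_sdiff, hv, Finset.mem_singleton]
  refine ⟨u, ((hu' u).mpr rfl).1, v, ((hv' v).mpr rfl).2, ?_⟩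
  ext a
  have := hu' a
  have := hv' a
  simp only [Finset.mem_insert, Finset.mem_erase]
  tauto

/-! ### Products of pair differences -/

section PairProduct

variable {α : Type*} [DecidableEq α] {q : ℕ}

/-- For `q` disjoint pairs of points `e (j, true)`, `e (j, false)`, the function of `S` given by
`∏ j, (1_S(e (j, true)) - 1_S(e (j, false)))`. For `S` of size `q` it is `±1` if `S` is a
transversal of the pairs and `0` otherwise. If `2 * q ≤ |α|`, these functions span the eigenspace of the least
eigenvalue of the Johnson graph on the `q`-subsets. -/
def pairProduct (e : Fin q × Bool ↪ α) (S : Finset α) : ℝ :=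
  ∏ j, ((if e (j, true) ∈ S then 1 else 0) - (if e (j, false) ∈ S then 1 else 0))

theorem pairProduct_map (e : Fin q × Bool ↪ α) (σ : Equiv.Perm α) (S : Finset α) :
    pairProduct (e.trans σ.toEmbedding) (S.map σ.toEmbedding) = pairProduct e S := by
  simp [pairProduct]

/-- If `S` is a transversal of the pairs, then exchanging `u ∈ S` for `v ∉ S` yields a transversal
only when `v` is the partner of `u`, and then exactly one factor changes sign. -/
theorem sum_pairProduct_exchange [Fintype α] (e : Fin q × Bool ↪ α) {S : Finset α}
    (hS : S.card = q) {u : α} (hu : u ∈ S) :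
    ∑ v ∈ Sᶜ, pairProduct e S * pairProduct e (insert v (S.erase u))
      = -(pairProduct e S * pairProduct e S) := by
  rw [← Finset.mul_sum, neg_mul_eq_mul_neg]
  by_cases h0 : pairProduct e S = 0
  · simp [h0]
  congr 1
  have hone : ∀ j, ∃ b, e (j, b) ∈ S ∧ e (j, !b) ∉ S := fun j => by
    have := (Finset.prod_ne_zero_iff.mp h0) j (Finset.mem_univ j)
    by_cases h1 : e (j, true) ∈ S <;> by_cases h2 : e (j, false) ∈ S
    · simp [h1, h2] at this
    · exact ⟨true, h1, h2⟩
    · exact ⟨false, h2, h1⟩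
    · simp [h1, h2] at this
  choose b hb hb' using hone
  have himage : Finset.univ.image (fun j => e (j, b j)) = S := by
    refine Finset.eq_of_subset_of_card_le (fun a ha => ?_) ?_
    · obtain ⟨j, -, rfl⟩ := Finset.mem_image.mp ha
      exact hb j
    · rw [Finset.card_image_of_injective _ fun i j h => (Prod.ext_iff.mp (e.injective h)).1]
      simp [hS]
  obtain ⟨j₀, -, rfl⟩ := Finset.mem_image.mp (himage.symm ▸ hu)
  rw [Finset.sum_eq_single (e (j₀, !b j₀))]
  · rw [pairProduct, pairProduct, ← Finset.mul_prod_erase _ _ (Finset.mem_univ j₀),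
      ← Finset.mul_prod_erase Finset.univ (fun j => ((if e (j, true) ∈ S then (1 : ℝ) else 0)
        - (if e (j, false) ∈ S then 1 else 0))) (Finset.mem_univ j₀), neg_mul_eq_neg_mul]
    congr 1
    · have h1 := hb j₀
      have h2 := hb' j₀
      cases hbj : b j₀ <;> simp [hbj] at h1 h2 <;> simp [h1, h2]
    · refine Finset.prod_congr rfl fun j hj => ?_
      have hj : j ≠ j₀ := Finset.ne_of_mem_erase hj
      simp [hj]
  · intro v hv hne
    have hv : v ∉ S := Finset.mem_compl.mp hv
    have h2 := hb' j₀
    refine Finset.prod_eq_zero (Finset.mem_univ j₀) ?_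
    have hv' : v ≠ e (j₀, b j₀) := fun h => hv (h ▸ hb j₀)
    cases hbj : b j₀ <;> simp only [hbj, Bool.not_true, Bool.not_false] at h2 hne hv' <;>
      simp [h2, hne.symm, hv'.symm]
  · intro h
    exact absurd (Finset.mem_compl.mpr (hb' j₀)) h

theorem sum_pairProduct_map [Fintype α] (σ : Equiv.Perm α) (S T : Finset α) :
    ∑ e : Fin q × Bool ↪ α, pairProduct e (S.map σ.toEmbedding) * pairProduct e (T.map σ.toEmbedding)
      = ∑ e : Fin q × Bool ↪ α, pairProduct e S * pairProduct e T := by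
  rw [← Equiv.sum_comp (Equiv.embeddingCongr (Equiv.refl _) σ)]
  refine Finset.sum_congr rfl fun e _ => ?_
  have : Equiv.embeddingCongr (Equiv.refl _) σ e = e.trans σ.toEmbedding := by
    ext; rfl
  rw [this, pairProduct_map, pairProduct_map]

theorem sum_pairProduct_self_pos [Fintype α] (hq : 2 * q ≤ Fintype.card α) {S : Finset α}
    (hS : S.card = q) : 0 < ∑ e : Fin q × Bool ↪ α, pairProduct e S * pairProduct e S := by
  obtain ⟨e⟩ : Nonempty (Fin q × Bool ↪ α) :=
    Function.Embedding.nonempty_of_card_le (by simpa [mul_comm] using hq)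
  set T : Finset α := Finset.univ.map ⟨fun j => e (j, true), fun i j h =>
    (Prod.ext_iff.mp (e.injective h)).1⟩ with hT
  have heT : pairProduct e T = 1 := by
    refine Finset.prod_eq_one fun j _ => ?_
    have h1 : e (j, true) ∈ T := Finset.mem_map_of_mem _ (Finset.mem_univ j)
    have h2 : e (j, false) ∉ T := fun h => by
      obtain ⟨i, -, hi⟩ := Finset.mem_map.mp h
      exact Bool.noConfusion (Prod.ext_iff.mp (e.injective hi)).2
    simp [h1, h2]
  obtain ⟨σ, hσ⟩ := Finset.exists_perm_map_eq (S := S) (T := T) (by simp [hT, hS])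
  rw [← sum_pairProduct_map σ, hσ]
  exact Finset.sum_pos' (fun e _ => mul_self_nonneg _) ⟨e, Finset.mem_univ e, by simp [heT]⟩

/-- All exchanges of `u` contribute equally, by symmetry under transpositions of the complement
of `S`. -/
theorem sum_pairProduct_mul_exchange [Fintype α] {S T : Finset α} (hS : S.card = q)
    (hT : T.card = q) (h : (S ∩ T).card + 1 = q) :
    (Sᶜ.card : ℝ) * ∑ e : Fin q × Bool ↪ α, pairProduct e S * pairProduct e T
      = -∑ e : Fin q × Bool ↪ α, pairProduct e S * pairProduct e S := by
  obtain ⟨u, hu, v, hv, rfl⟩ :=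
    Finset.eq_insert_erase_of_card_inter (hS.trans hT.symm) (h.trans hS.symm)
  have hswap : ∀ w ∈ Sᶜ,
      ∑ e : Fin q × Bool ↪ α, pairProduct e S * pairProduct e (insert w (S.erase u))
      = ∑ e : Fin q × Bool ↪ α, pairProduct e S * pairProduct e (insert v (S.erase u)) := by
    intro w hw
    have hw : w ∉ S := Finset.mem_compl.mp hw
    have hfix : ∀ R ⊆ S, R.map (Equiv.swap v w).toEmbedding = R := fun R hR => by
      refine Finset.eq_of_subset_of_card_le (fun b hb => ?_) (Finset.card_map _).ge
      obtain ⟨a, ha, rfl⟩ := Finset.mem_map.mp hb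
      have hav : a ≠ v := fun h => hv (h ▸ hR ha)
      have haw : a ≠ w := fun h => hw (h ▸ hR ha)
      rw [Equiv.coe_toEmbedding, Equiv.swap_apply_of_ne_of_ne hav haw]
      exact ha
    rw [← sum_pairProduct_map (Equiv.swap v w), hfix S subset_rfl, Finset.map_insert,
      hfix _ (Finset.erase_subset u S)]
    simp
  rw [← nsmul_eq_mul, ← Finset.sum_const, ← Finset.sum_congr rfl hswap, Finset.sum_comm,
    ← Finset.sum_neg_distrib]
  exact Finset.sum_congr rfl fun e _ => sum_pairProduct_exchange e hS hu

end PairProduct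

/-! ### Complements of Johnson graphs -/

/-- The dual certificate for complements of Johnson graphs, for `g : V → Finset α` an encoding of
the vertices by `m`-subsets. -/
theorem sum_le_of_mem_LSPlus_johnson {V α : Type*} [Fintype V] [DecidableEq V] [Fintype α]
    [DecidableEq α] {G : SimpleGraph V} {m : ℕ} (hm : 1 ≤ m) (hmα : 2 * m ≤ Fintype.card α)
    (g : V → Finset α) (hg : ∀ v, (g v).card = m)
    (hadj : ∀ v w, v ≠ w → ¬ G.Adj v w → (g v ∩ g w).card + 1 = m)
    {x : V → ℝ} (hx : x ∈ LSPlus (FRAC G)) : ∑ v, x v ≤ (Fintype.card α : ℝ) - m + 1 := by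
  have hmα' : (2 * m : ℝ) ≤ Fintype.card α := by exact_mod_cast hmα
  have hm' : (1 : ℝ) ≤ m := by exact_mod_cast hm
  obtain hV | ⟨⟨v₀⟩⟩ := isEmpty_or_nonempty V
  · rw [Finset.univ_eq_empty, Finset.sum_empty]
    linarith
  set D := ∑ e : Fin m × Bool ↪ α, pairProduct e (g v₀) * pairProduct e (g v₀) with hD
  have hconst : ∀ v, ∑ e : Fin m × Bool ↪ α, pairProduct e (g v) * pairProduct e (g v) = D := by
    intro v
    obtain ⟨σ, hσ⟩ := Finset.exists_perm_map_eq ((hg v).trans (hg v₀).symm)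
    rw [hD, ← hσ, sum_pairProduct_map]
  have hpos : (0 : ℝ) < Fintype.card α - m := by linarith
  have hDpos : 0 < D := sum_pairProduct_self_pos hmα (hg v₀)
  refine sum_le_of_mem_LSPlus hx (fun (e : Fin m × Bool ↪ α) v => pairProduct e (g v))
    (div_pos hDpos hpos) (by linarith) (fun v => ?_) (fun v w hvw h => ?_)
  · rw [hconst, add_sub_cancel_right, div_mul_cancel₀ _ hpos.ne']
  · have := sum_pairProduct_mul_exchange (hg v) (hg w) (hadj v w hvw h)
    rw [hconst, Finset.card_compl, hg, Nat.cast_sub (by omega)] at this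
    rw [← neg_div, eq_div_iff hpos.ne', ← this, mul_comm]

theorem card_compl_inter_compl_add {α : Type*} [Fintype α] [DecidableEq α] (S T : Finset α) :
    (Sᶜ ∩ Tᶜ).card + S.card + T.card = Fintype.card α + (S ∩ T).card := by
  have h1 := Finset.card_union_add_card_inter S T
  have h2 := Finset.card_compl_add_card (S ∪ T)
  rw [Finset.compl_union] at h2
  omega

theorem compl_johnsonGraph_not_adj {p q i : ℕ} (hi : 1 ≤ i) {S T : QSubset p q} :
    ¬ (johnsonGraph p q i hi)ᶜ.Adj S T ↔ S = T ∨ (S.1 ∩ T.1).card + i = q := by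
  rw [SimpleGraph.compl_adj, johnsonGraph_adj]
  tauto

/-- The `q`-subsets through a fixed `(q-1)`-subset are stable. -/
theorem le_indepNum_compl_johnsonGraph_of_subset {p q : ℕ} (hq : 1 ≤ q) (hqp : q ≤ p) :
    p - q + 1 ≤ ((johnsonGraph p q 1 le_rfl)ᶜ).indepNum := by
  obtain ⟨R, -, hR⟩ := Finset.exists_subset_card_eq
    (s := (Finset.univ : Finset (Fin p))) (n := q - 1) (by simp; omega)
  have hcard : ∀ v : {v // v ∈ Rᶜ}, (insert v.1 R).card = q := fun v => by
    rw [Finset.card_insert_of_notMem (Finset.mem_compl.mp v.2), hR]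
    omega
  have := card_le_indepNum (G := (johnsonGraph p q 1 le_rfl)ᶜ)
    (fun v : {v // v ∈ Rᶜ} => (⟨insert v.1 R, hcard v⟩ : QSubset p q)) ?_ ?_
  · rw [Fintype.card_coe, Finset.card_compl, hR, Fintype.card_fin] at this
    omega
  · intro v w h
    have hv : v.1 ∈ insert w.1 R := by
      have h' : insert v.1 R = insert w.1 R := congrArg Subtype.val h
      rw [← h']
      exact Finset.mem_insert_self _ _
    exact Subtype.ext ((Finset.mem_insert.mp hv).resolve_right (Finset.mem_compl.mp v.2))
  · intro v w
    rw [compl_johnsonGraph_not_adj]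
    by_cases hvw : v = w
    · exact Or.inl (by rw [hvw])
    · right
      have : insert v.1 R ∩ insert w.1 R = R := by
        have := Finset.mem_compl.mp v.2
        have := Finset.mem_compl.mp w.2
        have : v.1 ≠ w.1 := fun h => hvw (Subtype.ext h)
        ext a
        simp only [Finset.mem_inter, Finset.mem_insert]
        grind
      rw [this, hR]
      omega

/-- The `q`-subsets of a fixed `(q+1)`-subset are stable. -/
theorem le_indepNum_compl_johnsonGraph_of_superset {p q : ℕ} (hq : 1 ≤ q) (hqp : q < p) :
    q + 1 ≤ ((johnsonGraph p q 1 le_rfl)ᶜ).indepNum := by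
  obtain ⟨R, -, hR⟩ := Finset.exists_subset_card_eq
    (s := (Finset.univ : Finset (Fin p))) (n := q + 1) (by simp; omega)
  have hcard : ∀ v : {v // v ∈ R}, (R.erase v.1).card = q := fun v => by
    rw [Finset.card_erase_of_mem v.2, hR]
    omega
  have := card_le_indepNum (G := (johnsonGraph p q 1 le_rfl)ᶜ)
    (fun v : {v // v ∈ R} => (⟨R.erase v.1, hcard v⟩ : QSubset p q)) ?_ ?_
  · rwa [Fintype.card_coe, hR] at this
  · intro v w h
    have hv : v.1 ∉ R.erase w.1 := by
      have h' : R.erase v.1 = R.erase w.1 := congrArg Subtype.val h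
      rw [← h']
      exact Finset.notMem_erase _ _
    by_contra hne
    exact hv (Finset.mem_erase.mpr ⟨fun h => hne (Subtype.ext h), v.2⟩)
  · intro v w
    rw [compl_johnsonGraph_not_adj]
    by_cases hvw : v = w
    · exact Or.inl (by rw [hvw])
    · right
      have : R.erase v.1 ∩ R.erase w.1 = (R.erase v.1).erase w.1 := by
        ext a
        simp only [Finset.mem_inter, Finset.mem_erase]
        tauto
      rw [this, Finset.card_erase_of_mem
        (Finset.mem_erase.mpr ⟨fun h => hvw (Subtype.ext h.symm), w.2⟩), hcard]
      omega

/-! ### The least eigenvalue of the Kneser graph -/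

theorem card_qSubset (p q : ℕ) : Fintype.card (QSubset p q) = p.choose q := by
  simp [QSubset]

/-- The number of `k`-subsets containing `A` and avoiding `B`. -/
theorem Finset.card_filter_subset_disjoint {α : Type*} [Fintype α] [DecidableEq α] {A B : Finset α}
    (hAB : Disjoint A B) (k : ℕ) :
    (Finset.univ.filter fun T : Finset α => T.card = A.card + k ∧ A ⊆ T ∧ Disjoint T B).card
      = (Fintype.card α - A.card - B.card).choose k := by
  have hc : ((A ∪ B)ᶜ).card = Fintype.card α - A.card - B.card := by
    rw [Finset.card_compl, Finset.card_union_of_disjoint hAB]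
    omega
  rw [← hc, ← Finset.card_powersetCard]
  refine Finset.card_nbij' (· \ A) (· ∪ A) ?_ ?_ ?_ ?_
  · intro T hT
    simp only [Finset.coe_filter, Finset.mem_univ, true_and, Set.mem_ofPred_eq] at hT
    obtain ⟨h1, h2, h3⟩ := hT
    simp only [Finset.mem_coe, Finset.mem_powersetCard]
    refine ⟨fun a ha => ?_, ?_⟩
    · have := Finset.disjoint_left.mp h3
      simp only [Finset.mem_sdiff, Finset.mem_compl, Finset.mem_union] at ha ⊢
      have := @this a
      tauto
    · rw [Finset.card_sdiff_of_subset h2]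
      omega
  · intro R hR
    simp only [Finset.mem_coe, Finset.mem_powersetCard] at hR
    obtain ⟨h1, h2⟩ := hR
    have hd : Disjoint R (A ∪ B) := Finset.disjoint_left.mpr fun a ha =>
      Finset.mem_compl.mp (h1 ha)
    rw [Finset.disjoint_union_right] at hd
    simp only [Finset.coe_filter, Finset.mem_univ, true_and, Set.mem_ofPred_eq]
    refine ⟨?_, Finset.subset_union_right, Finset.disjoint_union_left.mpr ⟨hd.2, hAB⟩⟩
    rw [Finset.card_union_of_disjoint hd.1]
    omega
  · intro T hT
    simp only [Finset.coe_filter, Finset.mem_univ, true_and, Set.mem_ofPred_eq] at hT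
    exact Finset.sdiff_union_of_subset hT.2.1
  · intro R hR
    simp only [Finset.mem_coe, Finset.mem_powersetCard] at hR
    have hd : Disjoint R A := Finset.disjoint_left.mpr fun a ha h =>
      Finset.mem_compl.mp (hR.1 ha) (Finset.mem_union_left _ h)
    exact Finset.union_sdiff_cancel_right hd

theorem card_qSubset_subset_disjoint {p q : ℕ} {A B : Finset (Fin p)} (hAB : Disjoint A B)
    (hA : A.card ≤ q) :
    (Finset.univ.filter fun T : QSubset p q => A ⊆ T.1 ∧ Disjoint T.1 B).card
      = (p - A.card - B.card).choose (q - A.card) := by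
  have := Finset.card_filter_subset_disjoint hAB (q - A.card)
  rw [Fintype.card_fin] at this
  rw [← this]
  refine Finset.card_nbij Subtype.val ?_ Subtype.val_injective.injOn ?_
  · intro T hT
    simp only [Finset.coe_filter, Finset.mem_univ, true_and, Set.mem_ofPred_eq] at hT ⊢
    exact ⟨by rw [T.2]; omega, hT⟩
  · intro T hT
    simp only [Finset.coe_filter, Finset.mem_univ, true_and, Set.mem_ofPred_eq] at hT
    exact ⟨⟨T, by omega⟩, by simpa using hT.2, rfl⟩

section Kneser

variable {p q : ℕ}

/-- The permutation of the `q`-subsets induced by a permutation of the ground set. -/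
def QSubset.perm {p q : ℕ} (σ : Equiv.Perm (Fin p)) : Equiv.Perm (QSubset p q) where
  toFun S := ⟨S.1.map σ.toEmbedding, by rw [Finset.card_map, S.2]⟩
  invFun S := ⟨S.1.map σ.symm.toEmbedding, by rw [Finset.card_map, S.2]⟩
  left_inv S := by ext a; simp
  right_inv S := by ext a; simp

@[simp]
theorem QSubset.mem_perm {σ : Equiv.Perm (Fin p)} {S : QSubset p q} {a : Fin p} :
    a ∈ (QSubset.perm σ S).1 ↔ σ.symm a ∈ S.1 := by
  simp [QSubset.perm]

theorem QSubset.disjoint_perm (σ : Equiv.Perm (Fin p)) {S T : QSubset p q} :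
    Disjoint (QSubset.perm σ S).1 (QSubset.perm σ T).1 ↔ Disjoint S.1 T.1 := by
  simp [QSubset.perm, Finset.disjoint_map]

/-- A function on `q`-subsets invariant under transpositions is constant. -/
theorem QSubset.eq_of_forall_swap {v : QSubset p q → ℝ}
    (h : ∀ a b S, v (QSubset.perm (Equiv.swap a b) S) = v S) (S T : QSubset p q) : v S = v T := by
  have key : ∀ (σ : Equiv.Perm (Fin p)) S, v (QSubset.perm σ S) = v S := by
    intro σ
    induction σ using Equiv.Perm.swap_induction_on with
    | one => exact fun S => congrArg v (Subtype.ext (by ext a; simp [Equiv.Perm.one_def]))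
    | swap_mul f a b _ ih =>
      intro S
      rw [← ih S, ← h a b (QSubset.perm f S)]
      exact congrArg v (Subtype.ext (by ext c; simp [Equiv.Perm.mul_def]))
  obtain ⟨σ, hσ⟩ := Finset.exists_perm_map_eq (S.2.trans T.2.symm)
  rw [← key σ S]
  exact congrArg v (Subtype.ext hσ)

/-- If `w` is supported on the sets separating `a` from `b`, then among the sets `T` disjoint from
a set `S` of the support only those containing the other one of `a` and `b` contribute. -/
theorem abs_sum_disjoint_le {w : QSubset p q → ℝ} (hq : 1 ≤ q) {a b : Fin p}
    (hw : ∀ S : QSubset p q, (a ∈ S.1 ↔ b ∈ S.1) → w S = 0) {S : QSubset p q} (hS : w S ≠ 0)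
    (hmax : ∀ T, |w T| ≤ |w S|) :
    |∑ T : QSubset p q, if Disjoint S.1 T.1 then w T else 0|
      ≤ ((p - q - 1).choose (q - 1) : ℕ) * |w S| := by
  obtain ⟨c, hcS, hc⟩ : ∃ c ∉ S.1, ∀ T : QSubset p q, Disjoint S.1 T.1 → w T ≠ 0 → c ∈ T.1 := by
    have hsep : ¬ (a ∈ S.1 ↔ b ∈ S.1) := fun h => hS (hw S h)
    by_cases ha : a ∈ S.1
    · refine ⟨b, by tauto, fun T hT hT0 => ?_⟩
      have haT : a ∉ T.1 := Finset.disjoint_left.mp hT ha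
      have : ¬ (a ∈ T.1 ↔ b ∈ T.1) := fun h => hT0 (hw T h)
      tauto
    · refine ⟨a, ha, fun T hT hT0 => ?_⟩
      have hbT : b ∉ T.1 := Finset.disjoint_left.mp hT (by tauto)
      have : ¬ (a ∈ T.1 ↔ b ∈ T.1) := fun h => hT0 (hw T h)
      tauto
  have hcard := card_qSubset_subset_disjoint (q := q) (Finset.disjoint_singleton_left.mpr hcS)
    (by simpa using hq)
  rw [Finset.card_singleton, S.2, Nat.sub_right_comm] at hcard
  rw [← hcard, ← nsmul_eq_mul, ← Finset.sum_const, Finset.sum_filter]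
  refine (Finset.abs_sum_le_sum_abs _ _).trans (Finset.sum_le_sum fun T _ => ?_)
  by_cases hT : Disjoint S.1 T.1
  · by_cases hT0 : w T = 0
    · simp only [hT, if_true, hT0, abs_zero]
      split_ifs
      exacts [abs_nonneg _, le_rfl]
    · simp [hT, hT.symm, hc T hT hT0, hmax T]
  · simp only [hT, if_false, abs_zero]
    split_ifs
    exacts [abs_nonneg _, le_rfl]

/-- The matrix `x I + y A - x² J`, where `A` is the adjacency matrix of the Kneser graph. -/
def kneserSchur (p q : ℕ) (x y : ℝ) : Matrix (QSubset p q) (QSubset p q) ℝ :=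
  Matrix.of fun S T => (if S = T then x else 0) + (if Disjoint S.1 T.1 then y else 0) - x * x

theorem kneserSchur_sum_mul (x y : ℝ) (v : QSubset p q → ℝ) (S : QSubset p q) :
    ∑ T, kneserSchur p q x y S T * v T
      = x * v S + y * (∑ T : QSubset p q, if Disjoint S.1 T.1 then v T else 0)
        - x * x * ∑ T, v T := by
  have : ∀ T, kneserSchur p q x y S T * v T
      = (if S = T then x * v T else 0) + y * (if Disjoint S.1 T.1 then v T else 0)
        - x * x * v T := fun T => by
    simp only [kneserSchur, Matrix.of_apply]
    split_ifs <;> ring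
  simp only [this, Finset.sum_sub_distrib, Finset.sum_add_distrib, ← Finset.mul_sum,
    Finset.sum_ite_eq, Finset.mem_univ, if_true]

theorem kneserSchur_perm (x y : ℝ) (σ : Equiv.Perm (Fin p)) (S T : QSubset p q) :
    kneserSchur p q x y (QSubset.perm σ S) (QSubset.perm σ T) = kneserSchur p q x y S T := by
  simp [kneserSchur, QSubset.disjoint_perm]

/-- An eigenvector `v` is either constant, or for some transposition the difference `w` of `v` and
its image is an eigenvector for the same eigenvalue. The support of `w` consists of sets separating
two points, so that the eigenvalue can be bounded by the row sum at an entry of `w` of maximal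
absolute value. -/
theorem kneserSchur_eigenvalue_nonneg {x y : ℝ} (hq : 1 ≤ q) (hy : 0 ≤ y)
    (hxy : y * (p - q - 1).choose (q - 1) = x)
    (hrow : x + y * (p - q).choose q = x * x * p.choose q) {v : QSubset p q → ℝ} {μ : ℝ}
    (hv : ∀ S, ∑ T, kneserSchur p q x y S T * v T = μ * v S) (hv0 : v ≠ 0) : 0 ≤ μ := by
  by_cases hinv : ∀ a b S, v (QSubset.perm (Equiv.swap a b) S) = v S
  · obtain ⟨S, hS⟩ := Function.ne_iff.mp hv0
    have hconst : ∀ T, v T = v S := fun T => QSubset.eq_of_forall_swap hinv T S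
    have hdeg := card_qSubset_subset_disjoint (q := q) (Finset.disjoint_empty_left S.1) (by simp)
    simp only [Finset.empty_subset, true_and, Finset.card_empty, Nat.sub_zero, S.2] at hdeg
    have h := hv S
    rw [kneserSchur_sum_mul] at h
    simp only [hconst, disjoint_comm (a := S.1), ← Finset.sum_filter, Finset.sum_const, hdeg,
      Finset.card_univ, card_qSubset, nsmul_eq_mul] at h
    have : μ * v S = 0 := by
      rw [← h]
      linear_combination v S * hrow
    exact (mul_eq_zero.mp this).resolve_right hS |>.ge
  · push Not at hinv
    obtain ⟨a, b, S₁, hS₁⟩ := hinv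
    set τ := QSubset.perm (q := q) (Equiv.swap a b) with hτ
    set w : QSubset p q → ℝ := fun S => v (τ S) - v S with hw
    have hwsep : ∀ S : QSubset p q, (a ∈ S.1 ↔ b ∈ S.1) → w S = 0 := by
      intro S hS
      have : τ S = S := by
        refine Subtype.ext (Finset.ext fun c => ?_)
        rw [hτ, QSubset.mem_perm, Equiv.symm_swap]
        rcases eq_or_ne c a with rfl | hca
        · rw [Equiv.swap_apply_left, hS]
        rcases eq_or_ne c b with rfl | hcb
        · rw [Equiv.swap_apply_right, hS]
        · rw [Equiv.swap_apply_of_ne_of_ne hca hcb]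
      simp [hw, this]
    have hwμ : ∀ S, ∑ T, kneserSchur p q x y S T * w T = μ * w S := by
      intro S
      simp only [hw, mul_sub, Finset.sum_sub_distrib, hv S]
      rw [← hv (τ S), ← Equiv.sum_comp τ (fun T => kneserSchur p q x y (τ S) T * v T)]
      simp only [hτ, kneserSchur_perm]
    have hwsum : ∑ T, w T = 0 := by
      simp only [hw, Finset.sum_sub_distrib, Equiv.sum_comp τ v, sub_self]
    have : Nonempty (QSubset p q) := ⟨S₁⟩
    obtain ⟨S, hmax⟩ := Finite.exists_max fun S => |w S|
    have hS : w S ≠ 0 := fun h => by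
      have := hmax S₁
      rw [h, abs_zero, abs_nonpos_iff] at this
      exact hS₁ (sub_eq_zero.mp this)
    have hbound := abs_sum_disjoint_le hq hwsep hS hmax
    have h := hwμ S
    rw [kneserSchur_sum_mul, hwsum] at h
    set r := ∑ T : QSubset p q, if Disjoint S.1 T.1 then w T else 0
    have h1 : -(r * w S) ≤ (p - q - 1).choose (q - 1) * (w S * w S) := by
      calc -(r * w S) ≤ |r * w S| := neg_le_abs _
        _ = |r| * |w S| := abs_mul _ _
        _ ≤ (p - q - 1).choose (q - 1) * |w S| * |w S| :=
          mul_le_mul_of_nonneg_right hbound (abs_nonneg _)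
        _ = (p - q - 1).choose (q - 1) * (w S * w S) := by rw [mul_assoc, abs_mul_abs_self]
    have h2 : 0 ≤ μ * (w S * w S) := by
      have h3 : μ * (w S * w S) = x * (w S * w S) + y * (r * w S) := by
        linear_combination (-w S) * h
      have h4 := mul_le_mul_of_nonneg_left h1 hy
      rw [h3, ← hxy]
      linarith
    exact nonneg_of_mul_nonneg_left h2 (mul_self_pos.mpr hS)

theorem kneserSchur_posSemidef {x y : ℝ} (hq : 1 ≤ q) (hy : 0 ≤ y)
    (hxy : y * (p - q - 1).choose (q - 1) = x)
    (hrow : x + y * (p - q).choose q = x * x * p.choose q) :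
    (kneserSchur p q x y).PosSemidef := by
  have hH : (kneserSchur p q x y).IsHermitian := by
    ext S T
    simp [kneserSchur, eq_comm (a := T), disjoint_comm (a := T.1)]
  rw [hH.posSemidef_iff_eigenvalues_nonneg]
  intro i
  refine kneserSchur_eigenvalue_nonneg hq hy hxy hrow
    (v := fun S => hH.eigenvectorBasis i S) (fun S => ?_) ?_
  · simpa [Matrix.mulVec, dotProduct] using congrFun (hH.mulVec_eigenvectorBasis i) S
  · intro h
    exact hH.eigenvectorBasis.orthonormal.ne_zero i (by ext S; exact congrFun h S)

/-! ### The certificate for complements of Kneser graphs -/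

/-- The symmetric matrix with first row `(1, x, …, x)`, diagonal `(1, x, …, x)`, entries `y` at
the pairs of disjoint sets and `0` elsewhere. -/
def kneserCertificate (p q : ℕ) (x y : ℝ) :
    Matrix (Option (QSubset p q)) (Option (QSubset p q)) ℝ :=
  Matrix.of fun o o' => o.elim (o'.elim 1 fun _ => x) fun S => o'.elim x fun T =>
    (if S = T then x else 0) + if Disjoint S.1 T.1 then y else 0

theorem kneserCertificate_isSymm (x y : ℝ) : (kneserCertificate p q x y).IsSymm := by
  ext o o'
  cases o <;> cases o' <;>
    simp [kneserCertificate, eq_comm, disjoint_comm]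

/-- `kneserSchur` is the Schur complement of the entry at `0`. -/
theorem kneserCertificate_posSemidef {x y : ℝ} (h : (kneserSchur p q x y).PosSemidef) :
    (kneserCertificate p q x y).PosSemidef := by
  refine .of_dotProduct_mulVec_nonneg ?_ fun z => ?_
  · rw [Matrix.IsHermitian, Matrix.conjTranspose_eq_transpose_of_trivial]
    exact kneserCertificate_isSymm x y
  · have hM := h.dotProduct_mulVec_nonneg fun S => z (some S)
    have key : dotProduct (star z) ((kneserCertificate p q x y).mulVec z)
        = (z none + x * ∑ S, z (some S)) ^ 2 + dotProduct (star fun S => z (some S))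
          ((kneserSchur p q x y).mulVec fun S => z (some S)) := by
      have h1 : ∀ S : QSubset p q, ∑ T, kneserSchur p q x y S T * z (some T)
          = ∑ T, kneserCertificate p q x y (some S) (some T) * z (some T)
            - x * x * ∑ T, z (some T) := fun S => by
        rw [Finset.mul_sum, ← Finset.sum_sub_distrib]
        refine Finset.sum_congr rfl fun T _ => ?_
        simp only [kneserSchur, kneserCertificate, Matrix.of_apply, Option.elim]
        ring
      simp only [dotProduct, Matrix.mulVec, Fintype.sum_option, Pi.star_apply, star_trivial, h1,
        mul_sub, mul_add, Finset.sum_sub_distrib, Finset.sum_add_distrib, ← Finset.sum_mul]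
      have h2 : kneserCertificate p q x y none none = 1 := rfl
      have h3 : ∀ S, kneserCertificate p q x y none (some S) = x := fun _ => rfl
      have h4 : ∀ S, kneserCertificate p q x y (some S) none = x := fun _ => rfl
      simp only [h2, h3, h4, ← Finset.sum_mul, ← Finset.mul_sum]
      ring
    rw [key]
    exact add_nonneg (sq_nonneg _) hM

end Kneser

/-! ### Optimal values for complements of Kneser graphs -/

theorem Nat.le_choose_self {n k : ℕ} (hk : 1 ≤ k) (hkn : k < n) : n ≤ n.choose k := by
  induction n generalizing k with
  | zero => omega
  | succ n ih =>
    obtain ⟨j, rfl⟩ := Nat.exists_eq_add_of_le' hk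
    rw [Nat.choose_succ_succ']
    rcases Nat.lt_or_ge (j + 1) n with h | h
    · have := ih hk h
      have : 0 < n.choose j := Nat.choose_pos (by omega)
      omega
    · obtain rfl : n = j + 1 := by omega
      simp

section Kneser

variable {p q : ℕ}

theorem compl_kneserGraph_adj (hq : 1 ≤ q) {S T : QSubset p q} :
    (johnsonGraph p q q hq)ᶜ.Adj S T ↔ S ≠ T ∧ ¬ Disjoint S.1 T.1 := by
  rw [SimpleGraph.compl_adj, johnsonGraph_adj, Nat.add_eq_right, Finset.card_eq_zero,
    Finset.disjoint_iff_inter_eq_empty]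

theorem QSubset.ne_empty (hq : 1 ≤ q) (S : QSubset p q) : S.1 ≠ ∅ := by
  rw [ne_eq, ← Finset.card_eq_zero, S.2]
  omega

/-- If `p = 2 * q`, each set has only one disjoint partner, so that two adjacent sets cannot both
be disjoint from `S`; otherwise `2 * y ≤ x`. -/
theorem kneser_column_mem_FRAC {y : ℝ} (hq : 2 ≤ q) (hpq : 2 * q ≤ p) (hy : 0 ≤ y)
    (hxy : y * (p - q - 1).choose (q - 1) = 1) (S : QSubset p q) :
    (fun T : QSubset p q => (if T = S then 1 else 0) + if Disjoint T.1 S.1 then y else 0)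
      ∈ FRAC (johnsonGraph p q q (one_le_two.trans hq))ᶜ := by
  have hself := QSubset.ne_empty (one_le_two.trans hq) S
  have hpos : 0 < (p - q - 1).choose (q - 1) := Nat.choose_pos (by omega)
  have hpos' : (1 : ℝ) ≤ (p - q - 1).choose (q - 1) := by exact_mod_cast hpos
  have hy1 : y ≤ 1 := by nlinarith
  refine ⟨fun T => ?_, fun T T' h => ?_⟩
  · dsimp only
    by_cases hT : T = S
    · subst hT
      simp [hself]
    · simp only [hT, if_false, zero_add]
      split_ifs
      exacts [⟨hy, hy1⟩, ⟨le_rfl, zero_le_one⟩]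
  · rw [compl_kneserGraph_adj] at h
    obtain ⟨hne, hnd⟩ := h
    dsimp only
    by_cases hT : T = S
    · subst hT
      simp [hself, hne.symm, disjoint_comm (a := T'.1), hnd]
    by_cases hT' : T' = S
    · subst hT'
      simp [hself, hne, hnd]
    simp only [hT, hT', if_false, zero_add]
    by_cases hd : Disjoint T.1 S.1 ∧ Disjoint T'.1 S.1
    · have h2 : p ≠ 2 * q := by
        rintro rfl
        have hcompl : ∀ R : QSubset (2 * q) q, Disjoint R.1 S.1 → R.1 = S.1ᶜ := fun R hR =>
          Finset.eq_of_subset_of_card_le (Finset.subset_compl_iff_disjoint_right.mpr hR)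
            (by rw [Finset.card_compl, R.2, S.2, Fintype.card_fin]; omega)
        exact hne (Subtype.ext ((hcompl T hd.1).trans (hcompl T' hd.2).symm))
      have h3 : 2 ≤ (p - q - 1).choose (q - 1) :=
        le_trans (by omega) (Nat.le_choose_self (n := p - q - 1) (by omega) (by omega))
      have h3' : (2 : ℝ) ≤ (p - q - 1).choose (q - 1) := by exact_mod_cast h3
      simp only [hd.1, hd.2, if_true]
      nlinarith
    · rw [not_and_or] at hd
      rcases hd with hd | hd <;> simp only [hd, if_false] <;> split_ifs <;> linarith

theorem div_mem_lsPlusValues_kneser (hp : 4 ≤ p) (hq : 2 ≤ q) (hpq : 2 * q ≤ p) :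
    (p : ℝ) / q ∈ lsPlusValues (johnsonGraph p q q (one_le_two.trans hq))ᶜ := by
  have hq1 : 1 ≤ q := one_le_two.trans hq
  set N : ℝ := (((p - 1).choose (q - 1) : ℕ) : ℝ) with hN
  set d : ℝ := (((p - q - 1).choose (q - 1) : ℕ) : ℝ) with hd
  have hN3 : 3 ≤ N := by
    have : 3 ≤ (p - 1).choose (q - 1) :=
      le_trans (by omega) (Nat.le_choose_self (n := p - 1) (by omega) (by omega))
    rw [hN]
    exact_mod_cast this
  have hd1 : 1 ≤ d := by
    have : 1 ≤ (p - q - 1).choose (q - 1) := Nat.choose_pos (by omega)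
    rw [hd]
    exact_mod_cast this
  have hq0 : (q : ℝ) ≠ 0 := by
    have : q ≠ 0 := by omega
    exact_mod_cast this
  have hcard : (p.choose q : ℝ) = p * N / q := by
    rw [eq_div_iff hq0, hN]
    have := Nat.add_one_mul_choose_eq (p - 1) (q - 1)
    rw [show p - 1 + 1 = p by omega, show q - 1 + 1 = q by omega] at this
    exact_mod_cast this.symm
  have hdeg : ((p - q).choose q : ℝ) = (p - q) * d / q := by
    rw [eq_div_iff hq0, hd, ← Nat.cast_sub (by omega)]
    have := Nat.add_one_mul_choose_eq (p - q - 1) (q - 1)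
    rw [show p - q - 1 + 1 = p - q by omega, show q - 1 + 1 = q by omega] at this
    exact_mod_cast this.symm
  set x : ℝ := 1 / N with hx
  set y : ℝ := x / d with hy
  have hN0 : N ≠ 0 := by linarith
  have hd0 : d ≠ 0 := by linarith
  have hx0 : 0 < x := by positivity
  have hx3 : x ≤ 1 / 3 := one_div_le_one_div_of_le (by norm_num) hN3
  have hy0 : 0 ≤ y := by positivity
  have hyx : y ≤ x := div_le_self hx0.le hd1
  have hself : ∀ S : QSubset p q, S.1 ≠ ∅ := QSubset.ne_empty hq1
  have hcol : ∀ S, (kneserCertificate p q x y).mulVec (unitVec (some S)) =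
      fun o => o.elim x fun T => (if T = S then x else 0) + if Disjoint T.1 S.1 then y else 0 := by
    intro S
    ext o
    rw [unitVec, Matrix.mulVec_single_one]
    cases o <;> rfl
  have hcol0 : (kneserCertificate p q x y).mulVec (unitVec none) = liftVec fun _ => x := by
    ext o
    rw [unitVec, Matrix.mulVec_single_one]
    cases o <;> rfl
  refine ⟨fun _ => x, ⟨kneserCertificate p q x y, kneserCertificate_isSymm x y, hcol0, ?_,
    fun S => ⟨?_, ?_⟩, kneserCertificate_posSemidef (kneserSchur_posSemidef hq1 hy0 ?_ ?_)⟩, ?_⟩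
  · ext o
    cases o <;> simp [kneserCertificate, liftVec, hself]
  · rw [hcol]
    refine ⟨x, hx0.le, _, kneser_column_mem_FRAC (y := 1 / d) hq hpq (by positivity)
      (one_div_mul_cancel hd0) S, rfl, fun T => ?_⟩
    simp only [Option.elim, hy]
    split_ifs <;> ring
  -- the entries of `Y (e₀ - e_S)` lie between `0` and `x`, and `2 * x ≤ 1 - x`
  · have h1x : 0 < 1 - x := by linarith
    rw [Matrix.mulVec_sub, hcol, hcol0]
    set z : QSubset p q → ℝ := fun T =>
      x - ((if T = S then x else 0) + if Disjoint T.1 S.1 then y else 0) with hz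
    have hz0 : ∀ T, 0 ≤ z T := fun T => by
      simp only [hz]
      by_cases hT : T = S
      · subst hT
        simp [hself]
      · simp only [hT, if_false]
        split_ifs <;> linarith
    have hzx : ∀ T, z T ≤ x := fun T => by
      simp only [hz]
      split_ifs <;> linarith
    refine ⟨1 - x, h1x.le, fun T => z T / (1 - x), ⟨fun T => ⟨?_, ?_⟩, fun T T' _ => ?_⟩, rfl,
      fun T => ?_⟩
    · exact div_nonneg (hz0 T) h1x.le
    · rw [div_le_one h1x]
      linarith [hzx T]
    · rw [← add_div, div_le_one h1x]
      linarith [hzx T, hzx T']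
    · rw [mul_div_cancel₀ _ h1x.ne']
      rfl
  · rw [hy, ← hd, div_mul_cancel₀ _ hd0]
  · rw [hcard, hdeg, hy, hx]
    field_simp
    ring
  · rw [Finset.sum_const, Finset.card_univ, card_qSubset, nsmul_eq_mul, hcard, hx]
    field_simp

/-- The dual certificate is the Gram matrix of the vectors `1_S - q / p`. -/
theorem sum_le_of_mem_LSPlus_kneser (hq : 1 ≤ q) (hqp : q ≤ p) {x : QSubset p q → ℝ}
    (hx : x ∈ LSPlus (FRAC (johnsonGraph p q q hq)ᶜ)) : ∑ S, x S ≤ (p : ℝ) / q := by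
  have hq0 : (0 : ℝ) < q := by exact_mod_cast hq
  have hp0 : (0 : ℝ) < p := by exact_mod_cast hq.trans hqp
  have hgram : ∀ S T : QSubset p q, ∑ a : Fin p, ((if a ∈ S.1 then 1 else 0) - (q / p : ℝ))
      * ((if a ∈ T.1 then 1 else 0) - q / p) = (S.1 ∩ T.1).card - q * q / p := fun S T => by
    have : ∀ a : Fin p, ((if a ∈ S.1 then 1 else 0) - (q / p : ℝ))
        * ((if a ∈ T.1 then 1 else 0) - q / p)
        = (if a ∈ S.1 ∩ T.1 then 1 else 0) - q / p * (if a ∈ S.1 then 1 else 0)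
          - q / p * (if a ∈ T.1 then 1 else 0) + q / p * (q / p) := fun a => by
      simp only [Finset.mem_inter]
      by_cases h1 : a ∈ S.1 <;> by_cases h2 : a ∈ T.1 <;> simp [h1, h2] <;> ring
    simp only [this, Finset.sum_add_distrib, Finset.sum_sub_distrib, ← Finset.mul_sum,
      Finset.sum_boole, Finset.filter_mem_eq_inter, Finset.univ_inter, S.2, T.2, Finset.sum_const,
      Finset.card_univ, Fintype.card_fin, nsmul_eq_mul]
    field_simp
    ring
  refine sum_le_of_mem_LSPlus hx (fun (a : Fin p) S => (if a ∈ S.1 then 1 else 0) - (q / p : ℝ))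
    (c := q * q / p) (by positivity) (by positivity) (fun S => ?_) (fun S T hST h => ?_)
  · rw [hgram, Finset.inter_self, S.2]
    field_simp
  · rw [compl_kneserGraph_adj] at h
    have hd : Disjoint S.1 T.1 := by tauto
    rw [hgram, Finset.disjoint_iff_inter_eq_empty.mp hd]
    simp

/-- Disjoint blocks of `q` consecutive points are stable. -/
theorem div_le_indepNum_compl_kneserGraph (hq : 1 ≤ q) :
    p / q ≤ ((johnsonGraph p q q hq)ᶜ).indepNum := by
  have hlt : ∀ (j : Fin (p / q)) (i : Fin q), (finProdFinEquiv (j, i) : ℕ) < p := fun j i =>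
    (finProdFinEquiv (j, i)).2.trans_le (Nat.div_mul_le_self p q)
  set e : Fin (p / q) × Fin q ↪ Fin p := ⟨fun x => ⟨finProdFinEquiv x, hlt x.1 x.2⟩, fun x y h =>
    finProdFinEquiv.injective (Fin.ext (Fin.mk.inj h))⟩ with he
  have hinj : ∀ j, Function.Injective fun i : Fin q => e (j, i) := fun j i i' h =>
    (Prod.ext_iff.mp (e.injective h)).2
  set g : Fin (p / q) → QSubset p q := fun j => ⟨Finset.univ.map ⟨fun i => e (j, i), hinj j⟩,
    by simp⟩ with hg
  have hdisj : ∀ j k, j ≠ k → Disjoint (g j).1 (g k).1 := fun j k hjk => by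
    refine Finset.disjoint_left.mpr fun a ha hb => hjk ?_
    obtain ⟨i, -, rfl⟩ := Finset.mem_map.mp ha
    obtain ⟨i', -, h⟩ := Finset.mem_map.mp hb
    exact (Prod.ext_iff.mp (e.injective h)).1.symm
  have := card_le_indepNum (G := (johnsonGraph p q q hq)ᶜ) g ?_ ?_
  · rwa [Fintype.card_fin] at this
  · intro j k h
    by_contra hjk
    have := hdisj j k hjk
    rw [h] at this
    exact QSubset.ne_empty hq _ (disjoint_self.mp this)
  · intro j k
    rw [compl_kneserGraph_adj]
    rintro ⟨hne, hnd⟩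
    exact hnd (hdisj j k fun h => hne (h ▸ rfl))

end Kneser

/-! ### Both families of complements -/

theorem proposition6 (p q : ℕ) (hp : 4 ≤ p) (hq : 2 ≤ q) :
    -- (i) complements of Johnson graphs
    (∀ G : SimpleGraph (QSubset p q), G = (johnsonGraph p q 1 le_rfl)ᶜ →
      (2 * q ≤ p →
        IsGreatest (lsPlusValues G) (alphaLSPlus G) ∧
        alphaLSPlus G = (p : ℝ) - (q : ℝ) + 1 ∧
        (G.indepNum : ℝ) = (p : ℝ) - (q : ℝ) + 1) ∧
      (q < p → p < 2 * q →
        IsGreatest (lsPlusValues G) (alphaLSPlus G) ∧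
        alphaLSPlus G = (q : ℝ) + 1 ∧
        (G.indepNum : ℝ) = (q : ℝ) + 1)) ∧
    -- (ii) complements of Kneser graphs
    (∀ G : SimpleGraph (QSubset p q),
      G = (johnsonGraph p q q (le_trans one_le_two hq))ᶜ → 2 * q ≤ p →
        IsGreatest (lsPlusValues G) (alphaLSPlus G) ∧
        alphaLSPlus G = (p : ℝ) / (q : ℝ) ∧
        G.indepNum = ⌊(p : ℝ) / (q : ℝ)⌋₊ ∧
        (alphaLSPlus G = (G.indepNum : ℝ) ↔ q ∣ p)) := by
  have hq1 : 1 ≤ q := one_le_two.trans hq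
  refine ⟨?_, ?_⟩
  · rintro _ rfl
    refine ⟨fun hpq => ?_, fun hqp hpq => ?_⟩
    · refine alphaLSPlus_eq_of_le_indepNum (fun x hx => ?_) ?_
      · have := sum_le_of_mem_LSPlus_johnson hq1 (by simpa using hpq) Subtype.val (fun S => S.2)
          (fun S T hne h => ((compl_johnsonGraph_not_adj le_rfl).mp h).resolve_left hne) hx
        simpa using this
      · rw [← Nat.cast_sub (by omega)]
        exact_mod_cast le_indepNum_compl_johnsonGraph_of_subset hq1 (by omega)
    -- complementation turns the `q`-subsets into `(p - q)`-subsets, and `2 * (p - q) ≤ p`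
    · refine alphaLSPlus_eq_of_le_indepNum (fun x hx => ?_) ?_
      · have := sum_le_of_mem_LSPlus_johnson (m := p - q) (by omega)
          (by rw [Fintype.card_fin]; omega) (fun S : QSubset p q => S.1ᶜ)
          (fun S => by rw [Finset.card_compl, S.2, Fintype.card_fin])
          (fun S T hne h => by
            have h1 := ((compl_johnsonGraph_not_adj le_rfl).mp h).resolve_left hne
            have h2 := card_compl_inter_compl_add S.1 T.1
            rw [S.2, T.2, Fintype.card_fin] at h2
            omega) hx
        rwa [Fintype.card_fin, Nat.cast_sub hqp.le, sub_sub_cancel] at this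
      · exact_mod_cast le_indepNum_compl_johnsonGraph_of_superset hq1 hqp
  · rintro _ rfl hpq
    set G := (johnsonGraph p q q (le_trans one_le_two hq))ᶜ with hG
    have hmax : IsGreatest (lsPlusValues G) ((p : ℝ) / q) := by
      refine ⟨div_mem_lsPlusValues_kneser hp hq hpq, ?_⟩
      rintro _ ⟨x, hx, rfl⟩
      exact sum_le_of_mem_LSPlus_kneser hq1 (by omega) hx
    have halpha : alphaLSPlus G = (p : ℝ) / q := hmax.csSup_eq
    have hindep : G.indepNum = p / q := by
      refine le_antisymm ?_ (div_le_indepNum_compl_kneserGraph hq1)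
      rw [← Nat.floor_div_eq_div (K := ℝ)]
      exact Nat.le_floor (hmax.2 (indepNum_mem_lsPlusValues G))
    refine ⟨halpha ▸ hmax, halpha, by rw [hindep, Nat.floor_div_eq_div], ?_⟩
    have hq0 : (q : ℝ) ≠ 0 := by
      have : q ≠ 0 := by omega
      exact_mod_cast this
    rw [halpha, hindep, div_eq_iff hq0]
    norm_cast
    exact ⟨fun h => ⟨p / q, by rw [mul_comm]; exact h⟩, fun h => (Nat.div_mul_cancel h).symm⟩
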